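/- An \emph{aerial vector graph} on $n\ge 0$ numbered vertices is a directed graph $\Delta$ on these vertices in which at most one arrow starts at each vertex (loops are allowed). For a vertex $i$ let $\mathrm{Deb}(i)$ and $\mathrm{Fin}(i)$ be the sets of arrows starting, respectively ending, at $i$. Call $i$ \emph{simple} if $|\mathrm{Fin}(i)|\le 1$. Consider real linear combinations $\delta=\sum_\Delta a_\Delta\Delta$ of aerial vector graphs with $n$ vertices. For a permutation $\sigma$ of the vertices let $\sigma(\Delta)$ be the graph with arrows $\sigma(k)\to\sigma(a)$ for the arrows $k\to a$ of $\Delta$, and let $\varepsilon_{|\mathrm{Deb}(\Delta)|}(\sigma)=(-1)^q$, where $q$ is the number of pairs $k<l$ of vertices with $|\mathrm{Deb}(k)|=|\mathrm{Deb}(l)|=1$ in $\Delta$ and $\sigma(k)>\sigma(l)$. The combination $\delta$ is \emph{symmetric} if $a_{\sigma(\Delta)}=\varepsilon_{|\mathrm{Deb}(\Delta)|}(\sigma)\,a_\Delta$ for all $\sigma$ and $\Delta$. \emph{Coboundary.} Let $\Delta$ have $n$ vertices and let $i\ne j$ in $\{0,\dots,n\}$. Renumber the vertices of $\Delta$ by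 $0,\dots,\hat\jmath,\dots,n$, keeping their order. Let $\Delta'_{ji}\to_i^{prop}\Delta$ range over the graphs obtained by adding the vertex $j$ and an arrow $j\to i$, keeping $i$ as the origin of the arrow starting at $i$ (if any), and distributing the arrows of $\Delta$ ending at $i$ between $i$ and $j$ (all other arrow ends are unchanged), such that, if $i$ is not an isolated vertex of $\Delta$, one has $|\mathrm{Deb}(i)|+|\mathrm{Fin}(i)|>1$ and $|\mathrm{Deb}(j)|+|\mathrm{Fin}(j)|>1$ in $\Delta'_{ji}$. Put $$\partial\Delta=-\sum_{j\ne i}\ \sum_{\Delta'_{ji}\to_i^{prop}\Delta}\varepsilon_{|\mathrm{Deb}|}(j,0,\dots,\hat\jmath,\dots,n)\,\Delta'_{ji},$$ where the sign is $(-1)^m$, $m$ being the number of vertices $k<j$ of $\Delta'_{ji}$ with $|\mathrm{Deb}(k)|=1$, and extend $\partial$ linearly. A \emph{cocycle} is a symmetric $\delta$ with $\partial\delta=0$. A \emph{coboundary} on $n$ vertices is some $\partial\beta$ with $\beta$ a symmetric combination of graphs with $n-1$ vertices (for $n=0$ only $0$ is a coboundary). \emph{Symbol.} The order of a vertex $i$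 with $r=|\mathrm{Fin}(i)|$ is the symbol: $r$ if $r>1$ and $|\mathrm{Deb}(i)|=0$; $r^+$ if $r>1$ and $|\mathrm{Deb}(i)|=1$; $1^+$ if $r=1$ and $|\mathrm{Deb}(i)|=1$; $1$ if $r=1$ and $|\mathrm{Deb}(i)|=0$; $0$ if $r=0$ and $|\mathrm{Deb}(i)|=0$; $0^-$ if $r=0$ and $|\mathrm{Deb}(i)|=1$. These symbols are totally ordered by $r>s^+>1^+>1>0>0^-$ for all $r,s>1$, with $r>s$ and $r^+>s^+$ whenever $r>s$ as integers. The order of a graph is the word of the orders of its vertices, and words are compared lexicographically. The \emph{symbol} $\sigma_\delta$ of $\delta=\sum_\Delta a_\Delta\Delta$ is the sum of the $a_\Delta\Delta$ over the graphs $\Delta$ whose order is the greatest among the orders of the graphs with $a_\Delta\ne0$ (and $\sigma_0=0$). \textbf{Proposition.} Let $\delta$ be a cocycle of aerial vector graphs with $n$ vertices. Then there is a coboundary $\partial\beta$ such that $\delta-\partial\beta$ (again a cocycle) has a symbol $\sigma_{\delta-\partial\beta}$ which contains only graphs all of whose vertices are simple. -/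

import Mathlib

open Finset

namespace VectorGraph

/-- An aerial vector graph on the numbered vertices `Fin n`: at most one arrow starts at each
vertex (loops allowed). `Δ k = some a` means that `k → a` is an arrow of `Δ`, and `Δ k = none`
that no arrow starts at `k`. -/
abbrev Graph (n : ℕ) : Type := Fin n → Option (Fin n)

/-- `|Deb(i)|`, the number of arrows that start at `i`. -/
def deb {n : ℕ} (Δ : Graph n) (i : Fin n) : ℕ := if Δ i = none then 0 else 1

/-- `Fin(i)`: the arrows that end at `i`, each numbered by its origin. -/
def fin {n : ℕ} (Δ : Graph n) (i : Fin n) : Finset (Fin n) := univ.filter fun k => Δ k = some i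

/-- A vertex is simple if at most one arrow ends there. -/
def IsSimple {n : ℕ} (Δ : Graph n) (i : Fin n) : Prop := (fin Δ i).card ≤ 1

/-- The graph `σ(Δ)`: every vertex `k` of `Δ` is renamed `σ k`, and its arrows move with it. -/
def act {n : ℕ} (σ : Equiv.Perm (Fin n)) (Δ : Graph n) : Graph n :=
  fun k => (Δ (σ.symm k)).map σ

/-- The Koszul sign of the rearrangement that moves the object number `k`, of degree `d k`, to the
position `σ k`: the signature of the permutation induced on the objects of odd degree. -/
def koszulSign {n : ℕ} (d : Fin n → ℕ) (σ : Equiv.Perm (Fin n)) : ℤ :=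
  ∏ k, ∏ l, if k < l ∧ Odd (d k) ∧ Odd (d l) ∧ σ l < σ k then -1 else 1

/-- The sign `ε_{|Deb|}(j, 0, …, ĵ, …, n)` of a graph with vertices `0, …, n`; the permutation
`j.cycleRange` moves `j` to the position `0` and keeps the order of the other vertices. -/
def frontSign {n : ℕ} (Δ : Graph (n + 1)) (j : Fin (n + 1)) : ℤ :=
  koszulSign (deb Δ) j.cycleRange

/-- A linear combination `∑ a_Δ Δ` of aerial vector graphs with `n` vertices, given by its
coefficients `a_Δ`. -/
abbrev Comb (n : ℕ) : Type := Graph n → ℝ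

/-- Symmetric combinations. -/
def IsSymmetric {n : ℕ} (δ : Comb n) : Prop :=
  ∀ (σ : Equiv.Perm (Fin n)) (Δ : Graph n), δ (act σ Δ) = (koszulSign (deb Δ) σ : ℝ) * δ Δ

/-- `IsProperSplit Δ i j Δ'` : the graph `Δ'` is one of the graphs `Δ'_{ji}` obtained from `Δ` by
a proper splitting of its vertex `i`. The vertices of `Δ` are renumbered `0, …, ĵ, …, n` (by
`j.succAbove`), the vertex `j` and the arrow `j → i` are added, the arrow starting at `i` (if any)
still starts at `i`, and the arrows of `Δ` ending at `i` are distributed between `i` and `j`;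
unless `i` is isolated in `Δ`, at least two arrow ends must meet each of `i` and `j` in `Δ'`. -/
def IsProperSplit {n : ℕ} (Δ : Graph n) (i : Fin n) (j : Fin (n + 1)) (Δ' : Graph (n + 1)) :
    Prop :=
  Δ' j = some (j.succAbove i) ∧
  (∀ k, Δ k = none → Δ' (j.succAbove k) = none) ∧
  (∀ k a, Δ k = some a → a ≠ i → Δ' (j.succAbove k) = some (j.succAbove a)) ∧
  (∀ k, Δ k = some i →
    Δ' (j.succAbove k) = some (j.succAbove i) ∨ Δ' (j.succAbove k) = some j) ∧
  ((deb Δ i = 0 ∧ fin Δ i = ∅) ∨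
    1 < min (deb Δ' (j.succAbove i) + (fin Δ' (j.succAbove i)).card)
          (deb Δ' j + (fin Δ' j).card))

open Classical in
/-- The coboundary of one graph,
`∂Δ = -∑_{j ≠ i} ∑_{Δ'_{ji}} ε_{|Deb|}(j, 0, …, ĵ, …, n) Δ'_{ji}`. -/
noncomputable def graphCoboundary {n : ℕ} (Δ : Graph n) : Comb (n + 1) :=
  -∑ j : Fin (n + 1), ∑ i : Fin n, ∑ Δ' ∈ univ.filter (IsProperSplit Δ i j),
    Pi.single Δ' (frontSign Δ' j : ℝ)

/-- The coboundary operator, `∂(∑ a_Δ Δ) = ∑ a_Δ ∂Δ`. -/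
noncomputable def coboundary {n : ℕ} (δ : Comb n) : Comb (n + 1) :=
  ∑ Δ, δ Δ • graphCoboundary Δ

/-- Cocycles: symmetric combinations with zero coboundary. -/
def IsCocycle {n : ℕ} (δ : Comb n) : Prop := IsSymmetric δ ∧ coboundary δ = 0

/-- Coboundaries: the `∂β` with `β` a symmetric combination of graphs with one vertex less. There
are no graphs with `-1` vertices, so that for `n = 0` only `0` is a coboundary. -/
def IsCoboundary : {n : ℕ} → Comb n → Prop
  | 0, γ => γ = 0
  | _ + 1, γ => ∃ β, IsSymmetric β ∧ γ = coboundary β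

/-- The order of a vertex, in `ℕ × ℕ` with the lexicographic order. With `r = |Fin(i)|`, the
symbols `r` (`r > 1`), `r⁺` (`r > 1`), `1⁺`, `1`, `0`, `0⁻` are coded by
`(5, r)`, `(4, r)`, `(3, 1)`, `(2, 1)`, `(1, 0)`, `(0, 0)`. -/
def vertexOrder {n : ℕ} (Δ : Graph n) (i : Fin n) : ℕ ×ₗ ℕ :=
  let r := (fin Δ i).card
  toLex (if 1 < r then (if deb Δ i = 0 then 5 else 4)
    else if r = 1 then (if deb Δ i = 0 then 2 else 3)
    else (if deb Δ i = 0 then 1 else 0), r)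

/-- The order of a graph: the word of the orders of its vertices. Words are compared
lexicographically. -/
def graphOrder {n : ℕ} (Δ : Graph n) : Lex (Fin n → ℕ ×ₗ ℕ) := toLex (vertexOrder Δ)

open Classical in
/-- The symbol of `δ`: the part of `δ` carried by the graphs of greatest order among those that
occur in `δ`. -/
noncomputable def symbol {n : ℕ} (δ : Comb n) : Comb n :=
  fun Δ => if IsGreatest {w | ∃ Δ₀, δ Δ₀ ≠ 0 ∧ graphOrder Δ₀ = w} (graphOrder Δ) then δ Δ else 0

end VectorGraph

namespace VectorGraph

/-! The coefficient of `∂β` at `Γ` is a signed sum of `β` over the contractions of those arrows of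
`Γ` that a proper splitting can create. A hair is never such an arrow, and these contractions
preserve the hairs, so lengthening hairs acts as a contracting homotopy. Indeed, in `∂δ = 0` at
`grow Γ a`, contracting the new arrow `0 → t` returns `δ Γ`, and the other terms form a coboundary
at `Γ` (`eq_sum_of_coboundary_eq_zero`).

Averaging over all hairs keeps the symmetry and gives a primitive of the part of `δ` carried by
graphs with hairs (`coboundary_hairPrimitive`). The rest lives on hairless graphs, whose vertices
are all simple by a count (`isSimple_of_forall_not_isHair`). Thus all of `δ - ∂β`, not only its
symbol, has simple vertices; the order on graphs plays no role. -/

/-! ### Proper splittings as inverses of contractions -/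

/-- The vertex `t` meets an arrow end other than the end of the arrow `j → t`. -/
def MeetsOther {n : ℕ} (Γ : Graph n) (t j : Fin n) : Prop :=
  Γ t ≠ none ∨ ∃ k, k ≠ j ∧ Γ k = some t

/-- The arrow `j → j.succAbove i` of `Γ` comes from a proper splitting. -/
def IsContractible {n : ℕ} (Γ : Graph (n + 1)) (i : Fin n) (j : Fin (n + 1)) : Prop :=
  Γ j = some (j.succAbove i) ∧ ((∃ k, Γ k = some j) ↔ MeetsOther Γ (j.succAbove i) j)

/-- The map of vertices that identifies `j` with `j.succAbove i`. -/
def merge {n : ℕ} (i : Fin n) (j : Fin (n + 1)) : Fin (n + 1) → Fin n :=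
  j.insertNth (α := fun _ => Fin n) i id

/-- The graph obtained from `Γ` by contracting the arrow `j → j.succAbove i`. -/
def contract {n : ℕ} (Γ : Graph (n + 1)) (i : Fin n) (j : Fin (n + 1)) : Graph n :=
  fun k => (Γ (j.succAbove k)).map (merge i j)

@[simp] lemma merge_self {n : ℕ} (i : Fin n) (j : Fin (n + 1)) : merge i j j = i := by
  simp [merge]

@[simp] lemma merge_succAbove {n : ℕ} (i k : Fin n) (j : Fin (n + 1)) :
    merge i j (j.succAbove k) = k := by
  simp [merge]

lemma merge_eq_iff {n : ℕ} (i k : Fin n) (j b : Fin (n + 1)) :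
    merge i j b = k ↔ b = j.succAbove k ∨ (b = j ∧ k = i) := by
  rcases Fin.eq_self_or_eq_succAbove j b with rfl | ⟨c, rfl⟩
  · simp [(Fin.succAbove_ne _ _).symm, eq_comm]
  · simp [Fin.succAbove_ne]

lemma contract_eq_none {n : ℕ} (Γ : Graph (n + 1)) (i k : Fin n) (j : Fin (n + 1)) :
    contract Γ i j k = none ↔ Γ (j.succAbove k) = none := by
  simp [contract]

lemma contract_eq_some {n : ℕ} (Γ : Graph (n + 1)) (i k b : Fin n) (j : Fin (n + 1)) :
    contract Γ i j k = some b ↔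
      Γ (j.succAbove k) = some (j.succAbove b) ∨ (Γ (j.succAbove k) = some j ∧ b = i) := by
  simp only [contract, Option.map_eq_some_iff, merge_eq_iff]
  constructor
  · rintro ⟨c, h, rfl | ⟨rfl, rfl⟩⟩ <;> simp [h]
  · rintro (h | ⟨h, rfl⟩) <;> simp [h]

lemma deb_eq_zero_iff {n : ℕ} (Δ : Graph n) (i : Fin n) : deb Δ i = 0 ↔ Δ i = none := by
  unfold deb; split_ifs <;> simp_all

lemma odd_deb_iff {n : ℕ} (Δ : Graph n) (i : Fin n) : Odd (deb Δ i) ↔ Δ i ≠ none := by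
  unfold deb; split_ifs <;> simp_all

lemma fin_eq_empty_iff {n : ℕ} (Δ : Graph n) (i : Fin n) : fin Δ i = ∅ ↔ ∀ k, Δ k ≠ some i := by
  simp [fin, filter_eq_empty_iff]

lemma one_lt_valence_source {n : ℕ} {Γ : Graph n} {j : Fin n} (h : Γ j ≠ none) :
    1 < deb Γ j + (fin Γ j).card ↔ ∃ k, Γ k = some j := by
  have h1 : deb Γ j = 1 := by simp [deb, h]
  rw [h1, lt_add_iff_pos_right, card_pos]
  simp [fin, Finset.Nonempty]

lemma one_lt_valence_target {n : ℕ} {Γ : Graph n} {j t : Fin n} (h : Γ j = some t) :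
    1 < deb Γ t + (fin Γ t).card ↔ MeetsOther Γ t j := by
  have hj : j ∈ fin Γ t := by simp [fin, h]
  have hpos : 0 < (fin Γ t).card := card_pos.2 ⟨j, hj⟩
  unfold MeetsOther
  by_cases h0 : Γ t = none
  · have h1 : deb Γ t = 0 := by simp [deb, h0]
    rw [h1, zero_add, one_lt_card_iff_nontrivial]
    simp only [h0, ne_eq, not_true_eq_false, false_or]
    constructor
    · intro hn
      obtain ⟨k, hk, hkj⟩ := hn.exists_ne j
      exact ⟨k, hkj, by simpa [fin] using hk⟩
    · rintro ⟨k, hkj, hk⟩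
      exact ⟨k, by simp [fin, hk], j, hj, hkj⟩
  · have h1 : deb Γ t = 1 := by simp [deb, h0]
    simp only [h0, ne_eq, not_false_eq_true, true_or, iff_true]
    omega

lemma isolated_contract_iff {n : ℕ} {Γ : Graph (n + 1)} {i : Fin n} {j : Fin (n + 1)}
    (h : Γ j = some (j.succAbove i)) :
    (deb (contract Γ i j) i = 0 ∧ fin (contract Γ i j) i = ∅) ↔
      (¬ ∃ k, Γ k = some j) ∧ ¬ MeetsOther Γ (j.succAbove i) j := by
  rw [deb_eq_zero_iff, fin_eq_empty_iff, contract_eq_none]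
  simp only [ne_eq, contract_eq_some, and_true, MeetsOther, not_or, not_exists, not_and, not_not,
    Fin.forall_iff_succAbove j, h, Fin.succAbove_ne, not_false_eq_true, true_and, forall_true_left,
    Option.some.injEq, not_true_eq_false, IsEmpty.forall_iff]
  grind

/-- A contraction undoes a splitting. The split vertex was isolated when neither end of `j → i`
meets another arrow end, and the valence condition says that both do; together these are the
equivalence in `IsContractible`. -/
lemma isProperSplit_iff {n : ℕ} (Δ : Graph n) (i : Fin n) (j : Fin (n + 1)) (Γ : Graph (n + 1)) :
    IsProperSplit Δ i j Γ ↔ Δ = contract Γ i j ∧ IsContractible Γ i j := by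
  have key (hj : Γ j = some (j.succAbove i)) :
      ((∀ k, Δ k = none → Γ (j.succAbove k) = none) ∧
      (∀ k a, Δ k = some a → a ≠ i → Γ (j.succAbove k) = some (j.succAbove a)) ∧
      (∀ k, Δ k = some i →
        Γ (j.succAbove k) = some (j.succAbove i) ∨ Γ (j.succAbove k) = some j)) ↔
      Δ = contract Γ i j := by
    constructor
    · rintro ⟨h1, h2, h3⟩
      funext k
      rcases hk : Δ k with _ | a
      · exact ((contract_eq_none Γ i k j).2 (h1 k hk)).symm
      · refine ((contract_eq_some Γ i k a j).2 ?_).symm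
        by_cases ha : a = i
        · subst ha
          simpa using h3 k hk
        · exact Or.inl (h2 k a hk ha)
    · rintro rfl
      refine ⟨fun k hk => (contract_eq_none Γ i k j).1 hk, fun k a hk ha => ?_, fun k hk => ?_⟩
      · simpa [ha] using (contract_eq_some Γ i k a j).1 hk
      · simpa using (contract_eq_some Γ i k i j).1 hk
  unfold IsProperSplit IsContractible
  constructor
  · rintro ⟨hj, h1, h2, h3, h4⟩
    obtain rfl := (key hj).1 ⟨h1, h2, h3⟩
    rw [isolated_contract_iff hj, lt_min_iff, one_lt_valence_target hj,
      one_lt_valence_source (by simp [hj])] at h4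
    exact ⟨rfl, hj, by grind⟩
  · rintro ⟨rfl, hj, h⟩
    obtain ⟨h1, h2, h3⟩ := (key hj).2 rfl
    refine ⟨hj, h1, h2, h3, ?_⟩
    rw [isolated_contract_iff hj, lt_min_iff, one_lt_valence_target hj,
      one_lt_valence_source (by simp [hj])]
    tauto

open Classical in
lemma coboundary_apply {n : ℕ} (β : Comb n) (Γ : Graph (n + 1)) :
    coboundary β Γ = -∑ j, ∑ i,
      if IsContractible Γ i j then (frontSign Γ j : ℝ) * β (contract Γ i j) else 0 := by
  have h1 (Δ : Graph n) : graphCoboundary Δ Γ = -∑ j, ∑ i,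
      if Δ = contract Γ i j then (if IsContractible Γ i j then (frontSign Γ j : ℝ) else 0)
      else 0 := by
    unfold graphCoboundary
    simp only [Pi.neg_apply, Finset.sum_apply, Pi.single_apply, sum_ite_eq, mem_filter, mem_univ,
      true_and, isProperSplit_iff, ite_and]
  simp only [coboundary, Finset.sum_apply, Pi.smul_apply, smul_eq_mul, h1, mul_neg, sum_neg_distrib,
    mul_sum, mul_ite, mul_zero]
  rw [sum_comm]
  congr 1
  refine sum_congr rfl fun j _ => ?_
  rw [sum_comm]
  refine sum_congr rfl fun i _ => ?_
  rw [sum_ite_eq' univ (contract Γ i j)]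
  simp [mul_comm]

/-! ### Hairs and their invariance under contraction -/

/-- A hair: an arrow starts at `a`, none ends there, and the target of this arrow meets another
arrow end. -/
def IsHair {n : ℕ} (Γ : Graph n) (a : Fin n) : Prop :=
  (∀ k, Γ k ≠ some a) ∧ ∃ t, Γ a = some t ∧ MeetsOther Γ t a

lemma IsContractible.not_isHair {n : ℕ} {Γ : Graph (n + 1)} {i : Fin n} {j : Fin (n + 1)}
    (h : IsContractible Γ i j) : ¬ IsHair Γ j := by
  rintro ⟨h1, t, h2, h3⟩
  obtain ⟨h4, h5⟩ := h
  obtain rfl : j.succAbove i = t := by simpa [h4] using h2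
  obtain ⟨k, hk⟩ := h5.2 h3
  exact h1 k hk

/-- Only the merged vertex matters. By properness, if one end of the contracted arrow meets another
arrow end, so does the other; hence contraction neither frees a vertex of incoming arrows nor
isolates the target of a hair. -/
lemma IsContractible.isHair_contract {n : ℕ} {Γ : Graph (n + 1)} {i : Fin n} {j : Fin (n + 1)}
    (h : IsContractible Γ i j) (a : Fin n) :
    IsHair (contract Γ i j) a ↔ IsHair Γ (j.succAbove a) := by
  obtain ⟨hj, hP⟩ := h
  have hc := contract_eq_some Γ i
  have hn := contract_eq_none Γ i
  have hne := Fin.succAbove_ne j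
  have hinj (b c : Fin n) : j.succAbove b = j.succAbove c ↔ b = c := Fin.succAbove_right_inj
  have hcov := Fin.eq_self_or_eq_succAbove j
  unfold MeetsOther at hP
  constructor
  · rintro ⟨h1, b, h2, h3⟩
    have h4 (k) : Γ k ≠ some (j.succAbove a) := by
      intro hk
      rcases hcov k with rfl | ⟨k, rfl⟩
      · obtain rfl : i = a := by grind
        obtain ⟨w, hw⟩ := hP.2 (Or.inl (by grind))
        rcases hcov w with rfl | ⟨w, rfl⟩
        · grind
        · exact h1 w ((hc ..).2 (Or.inr ⟨hw, rfl⟩))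
      · exact h1 k ((hc ..).2 (Or.inl hk))
    refine ⟨h4, ?_⟩
    rcases (hc ..).1 h2 with h2 | ⟨h5, rfl⟩
    · refine ⟨_, h2, ?_⟩
      rcases h3 with h3 | ⟨k, hk, h3⟩
      · exact Or.inl (by grind)
      · rcases (hc ..).1 h3 with h3 | ⟨h3, rfl⟩
        · exact Or.inr ⟨_, by grind, h3⟩
        · exact Or.inr ⟨j, (hne a).symm, hj⟩
    · exact ⟨j, h5, Or.inl (by simp [hj])⟩
  · rintro ⟨h1, t, h2, h3⟩
    have h4 (k) : contract Γ i j k ≠ some a := by grind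
    refine ⟨h4, ?_⟩
    rcases hcov t with rfl | ⟨b, rfl⟩
    · refine ⟨i, (hc ..).2 (Or.inr ⟨h2, rfl⟩), ?_⟩
      rcases hP.1 ⟨_, h2⟩ with h | ⟨k, hk, h⟩
      · exact Or.inl (by grind)
      · rcases hcov k with rfl | ⟨k, rfl⟩
        · exact absurd rfl hk
        · exact Or.inr ⟨k, by grind, (hc ..).2 (Or.inl h)⟩
    · refine ⟨b, (hc ..).2 (Or.inl h2), ?_⟩
      by_cases hb : b = i
      · subst hb
        -- The other end met by the target may be that of `j → i` itself, which disappears.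
        -- Properness supplies an arrow into `j`, which survives as an arrow into `i`.
        obtain ⟨k, hk⟩ := hP.2 (Or.inr ⟨_, hne a, h2⟩)
        rcases hcov k with rfl | ⟨k, rfl⟩
        · grind
        · exact Or.inr ⟨k, by grind, (hc ..).2 (Or.inr ⟨hk, rfl⟩)⟩
      · rcases h3 with h3 | ⟨k, hk, h3⟩
        · exact Or.inl (by grind)
        · rcases hcov k with rfl | ⟨k, rfl⟩
          · grind
          · exact Or.inr ⟨k, by grind, (hc ..).2 (Or.inl h3)⟩

/-! ### Lengthening a hair -/

/-- The graph obtained by inserting a new vertex `0` on the arrow that starts at `a`. -/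
def grow {n : ℕ} (Γ : Graph n) (a : Fin n) : Graph (n + 1) :=
  Fin.cons ((Γ a).map Fin.succ) fun k => if k = a then some 0 else (Γ k).map Fin.succ

@[simp] lemma grow_zero {n : ℕ} (Γ : Graph n) (a : Fin n) :
    grow Γ a 0 = (Γ a).map Fin.succ := rfl

@[simp] lemma grow_succ {n : ℕ} (Γ : Graph n) (a k : Fin n) :
    grow Γ a k.succ = if k = a then some 0 else (Γ k).map Fin.succ := rfl

lemma map_succ_eq_some_succ {n : ℕ} (o : Option (Fin n)) (t : Fin n) :
    o.map Fin.succ = some t.succ ↔ o = some t := by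
  cases o <;> simp

lemma map_succ_ne_some_zero {n : ℕ} (o : Option (Fin n)) :
    o.map Fin.succ ≠ some 0 := by
  cases o <;> simp [Fin.succ_ne_zero]

/-- The arrow that starts at `a` in `grow Γ a` ends at the new vertex. -/
lemma exists_grow_eq_zero {n : ℕ} (Γ : Graph n) (a : Fin n) : ∃ k, grow Γ a k = some 0 :=
  ⟨a.succ, by simp⟩

lemma exists_grow_eq_succ {n : ℕ} (Γ : Graph n) (a j : Fin n) :
    (∃ k, grow Γ a k = some j.succ) ↔ ∃ k, Γ k = some j := by
  rw [Fin.exists_fin_succ]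
  simp only [grow_zero, grow_succ, map_succ_eq_some_succ]
  constructor
  · rintro (h | ⟨k, h⟩)
    · exact ⟨a, h⟩
    · split_ifs at h with hk
      · simp [(Fin.succ_ne_zero _).symm] at h
      · exact ⟨k, (map_succ_eq_some_succ _ _).1 h⟩
  · rintro ⟨k, h⟩
    by_cases hk : k = a
    · exact Or.inl (hk ▸ h)
    · exact Or.inr ⟨k, by simp [hk, h]⟩

lemma grow_succ_eq_none {n : ℕ} {Γ : Graph n} {a : Fin n} (ha : Γ a ≠ none) (k : Fin n) :
    grow Γ a k.succ = none ↔ Γ k = none := by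
  rw [grow_succ]; split_ifs with h <;> simp_all

lemma meetsOther_grow_zero {n : ℕ} {Γ : Graph n} {a : Fin n} (ha : Γ a ≠ none) (t : Fin n) :
    MeetsOther (grow Γ a) t.succ 0 ↔ MeetsOther Γ t a := by
  unfold MeetsOther
  rw [ne_eq, grow_succ_eq_none ha, Fin.exists_fin_succ]
  refine or_congr Iff.rfl ?_
  simp only [ne_eq, not_true_eq_false, false_and, false_or, Fin.succ_ne_zero, not_false_eq_true,
    true_and, grow_succ]
  refine exists_congr fun k => ?_
  by_cases hk : k = a
  · simp [hk, (Fin.succ_ne_zero _).symm]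
  · simp [hk]

lemma meetsOther_grow_succ {n : ℕ} {Γ : Graph n} {a : Fin n} (ha : Γ a ≠ none) (t j : Fin n)
    (hj : j ≠ a) :
    MeetsOther (grow Γ a) t.succ j.succ ↔ MeetsOther Γ t j := by
  unfold MeetsOther
  rw [ne_eq, grow_succ_eq_none ha, Fin.exists_fin_succ]
  refine or_congr Iff.rfl ?_
  simp only [grow_zero, map_succ_eq_some_succ, ne_eq, (Fin.succ_ne_zero _).symm, not_false_eq_true,
    true_and, Fin.succ_inj, grow_succ]
  constructor
  · rintro (h | ⟨k, hk, h⟩)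
    · exact ⟨a, hj.symm, h⟩
    · split_ifs at h with hka
      · simp [(Fin.succ_ne_zero _).symm] at h
      · exact ⟨k, hk, (map_succ_eq_some_succ _ _).1 h⟩
  · rintro ⟨k, hk, h⟩
    by_cases hka : k = a
    · exact Or.inl (hka ▸ h)
    · exact Or.inr ⟨k, hk, by simp [hka, h]⟩

lemma isContractible_grow_zero {n : ℕ} {Γ : Graph n} {a t : Fin n} (hat : Γ a = some t)
    (ht : MeetsOther Γ t a) (i : Fin n) :
    IsContractible (grow Γ a) i 0 ↔ i = t := by
  unfold IsContractible
  rw [Fin.succAbove_zero, grow_zero, map_succ_eq_some_succ, hat, Option.some_inj]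
  constructor
  · rintro ⟨h, -⟩
    exact h.symm
  · rintro rfl
    refine ⟨rfl, iff_of_true (exists_grow_eq_zero Γ a) ?_⟩
    rwa [meetsOther_grow_zero (by simp [hat])]

lemma contract_grow_zero {n : ℕ} {Γ : Graph n} {a t : Fin n} (hat : Γ a = some t) :
    contract (grow Γ a) t 0 = Γ := by
  funext k
  have hs (b : Fin n) : merge t 0 b.succ = b := merge_succAbove t b 0
  simp only [contract, Fin.succAbove_zero, grow_succ]
  split_ifs with hk
  · simp [hk, hat]
  · cases Γ k <;> simp [hs]

/-- The only arrow into `0` starts at the old hair vertex, where nothing ends, while `0` has an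
outgoing arrow; so properness fails. -/
lemma not_isContractible_grow_succ_zero {n : ℕ} {Γ : Graph (n + 1)} {a : Fin (n + 1)}
    (ha : IsHair Γ a) (j : Fin (n + 1)) : ¬ IsContractible (grow Γ a) 0 j.succ := by
  rintro ⟨h1, h2⟩
  obtain ⟨h3, t, h4, -⟩ := ha
  rw [Fin.succ_succAbove_zero] at h1 h2
  have hj : j = a := by
    by_contra hj
    rw [grow_succ, if_neg hj] at h1
    exact map_succ_ne_some_zero _ h1
  subst hj
  rw [exists_grow_eq_succ] at h2
  obtain ⟨k, hk⟩ := h2.2 (Or.inl (by simp [h4]))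
  exact h3 k hk

lemma isContractible_grow_succ_succ {n : ℕ} {Γ : Graph (n + 1)} {a : Fin (n + 1)}
    (ha : IsHair Γ a) (i : Fin n) (j : Fin (n + 1)) :
    IsContractible (grow Γ a) i.succ j.succ ↔ IsContractible Γ i j := by
  by_cases hj : j = a
  · subst hj
    refine iff_of_false ?_ fun h => h.not_isHair ha
    rintro ⟨h, -⟩
    simp [(Fin.succ_ne_zero _).symm] at h
  · obtain ⟨-, t, h, -⟩ := ha
    unfold IsContractible
    rw [Fin.succ_succAbove_succ, meetsOther_grow_succ (by simp [h]) _ _ hj, exists_grow_eq_succ,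
      grow_succ, if_neg hj, map_succ_eq_some_succ]

lemma merge_succ_zero {n : ℕ} (i : Fin n) (j : Fin (n + 1)) : merge i.succ j.succ 0 = 0 := by
  simpa using merge_succAbove i.succ 0 j.succ

lemma merge_succ_succ {n : ℕ} (i : Fin n) (j b : Fin (n + 1)) :
    merge i.succ j.succ b.succ = (merge i j b).succ := by
  rcases Fin.eq_self_or_eq_succAbove j b with rfl | ⟨c, rfl⟩
  · simp
  · simpa using merge_succAbove i.succ c.succ j.succ

lemma contract_grow_succ {n : ℕ} (Γ : Graph (n + 1)) (a i : Fin n) (j : Fin (n + 1)) :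
    contract (grow Γ (j.succAbove a)) i.succ j.succ = grow (contract Γ i j) a := by
  have hm (o : Option (Fin (n + 1))) :
      (o.map Fin.succ).map (merge i.succ j.succ) = (o.map (merge i j)).map Fin.succ := by
    cases o <;> simp [merge_succ_succ]
  funext k
  refine Fin.cases ?_ (fun k => ?_) k
  · simp only [contract, Fin.succ_succAbove_zero, grow_zero, hm]
  · simp only [contract, Fin.succ_succAbove_succ, grow_succ, Fin.succAbove_right_inj]
    split_ifs with hk
    · simp [merge_succ_zero]
    · exact hm _

/-! ### Signs and the homotopy identity -/

/-- The cycle inverts exactly the pairs `(k, j)` with `k < j`. -/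
lemma koszulSign_cycleRange {n : ℕ} (d : Fin (n + 1) → ℕ) (j : Fin (n + 1)) :
    koszulSign d j.cycleRange = ∏ k, if k < j ∧ Odd (d k) ∧ Odd (d j) then -1 else 1 := by
  unfold koszulSign
  refine prod_congr rfl fun k _ => ?_
  have h (l : Fin (n + 1)) : (k < l ∧ Odd (d k) ∧ Odd (d l) ∧ j.cycleRange l < j.cycleRange k) ↔
      l = j ∧ (k < j ∧ Odd (d k) ∧ Odd (d j)) := by
    have : (k < l ∧ j.cycleRange l < j.cycleRange k) ↔ l = j ∧ k < j := by
      rcases Fin.eq_self_or_eq_succAbove j l with rfl | ⟨l, rfl⟩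
      · rcases Fin.eq_self_or_eq_succAbove l k with rfl | ⟨k, rfl⟩
        · simp
        · simp [Fin.cycleRange_self, Fin.cycleRange_succAbove]
      · rcases Fin.eq_self_or_eq_succAbove j k with rfl | ⟨k, rfl⟩
        · simp [Fin.succAbove_ne]
        · simp only [Fin.cycleRange_succAbove, Fin.succAbove_ne, false_and, iff_false, not_and,
            not_lt, Fin.succ_le_succ_iff]
          intro h
          exact ((Fin.strictMono_succAbove j).lt_iff_lt.1 h).le
    constructor
    · rintro ⟨h1, h2, h3, h4⟩
      obtain ⟨rfl, h5⟩ := this.1 ⟨h1, h4⟩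
      exact ⟨rfl, h5, h2, h3⟩
    · rintro ⟨rfl, h1, h2, h3⟩
      exact ⟨h1, h2, h3, (this.2 ⟨rfl, h1⟩).2⟩
  simp only [h, ite_and]
  simp

lemma frontSign_zero {n : ℕ} (Γ : Graph (n + 1)) : frontSign Γ 0 = 1 := by
  simp only [frontSign, koszulSign_cycleRange]
  simp

/-- The new vertex `0` is odd and precedes `j.succ`, which costs one more sign; the other degrees
are unchanged. -/
lemma frontSign_grow {n : ℕ} {Γ : Graph (n + 1)} {a j : Fin (n + 1)} (ha : Γ a ≠ none)
    (hj : Γ j ≠ none) : frontSign (grow Γ a) j.succ = -frontSign Γ j := by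
  have h0 : grow Γ a 0 ≠ none := by simpa using ha
  simp only [frontSign, koszulSign_cycleRange, odd_deb_iff, Fin.prod_univ_succ (n := n + 1)]
  simp [Fin.succ_pos, h0, grow_succ_eq_none ha, hj, -grow_zero, -grow_succ]

open Classical in
lemma eq_sum_of_coboundary_eq_zero {n : ℕ} {δ : Comb (n + 1)} (hδ : coboundary δ = 0)
    {Γ : Graph (n + 1)} {a : Fin (n + 1)} (ha : IsHair Γ a) :
    δ Γ = ∑ j, ∑ i, if IsContractible Γ i j then
      (frontSign Γ j : ℝ) * δ (contract (grow Γ a) i.succ j.succ) else 0 := by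
  have h := congr_fun hδ (grow Γ a)
  obtain ⟨h1, t, hat, ht⟩ := id ha
  have h2 (j : Fin (n + 1)) : (∑ i, if IsContractible (grow Γ a) i j.succ then
      (frontSign (grow Γ a) j.succ : ℝ) * δ (contract (grow Γ a) i j.succ) else 0) =
      -∑ i : Fin n, if IsContractible Γ i j then
      (frontSign Γ j : ℝ) * δ (contract (grow Γ a) i.succ j.succ) else 0 := by
    rw [Fin.sum_univ_succ, if_neg (not_isContractible_grow_succ_zero ha j), zero_add,
      ← sum_neg_distrib]
    refine sum_congr rfl fun i _ => ?_
    simp only [isContractible_grow_succ_succ ha]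
    split_ifs with hc
    · rw [frontSign_grow (by simp [hat]) (by simp [hc.1])]
      push_cast
      ring
    · simp
  rw [coboundary_apply, Fin.sum_univ_succ] at h
  simp only [isContractible_grow_zero hat ht, sum_ite_eq', mem_univ, if_true, frontSign_zero,
    contract_grow_zero hat, h2, sum_neg_distrib, Int.cast_one, one_mul, Pi.zero_apply] at h
  linarith

/-! ### Equivariance under renumbering -/

@[simp] lemma act_apply {n : ℕ} (σ : Equiv.Perm (Fin n)) (Γ : Graph n) (k : Fin n) :
    act σ Γ (σ k) = (Γ k).map σ := by
  simp [act]

lemma map_perm_eq_some {n : ℕ} (σ : Equiv.Perm (Fin n)) (o : Option (Fin n)) (t : Fin n) :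
    o.map σ = some (σ t) ↔ o = some t := by
  cases o <;> simp

lemma meetsOther_act {n : ℕ} (σ : Equiv.Perm (Fin n)) (Γ : Graph n) (t j : Fin n) :
    MeetsOther (act σ Γ) (σ t) (σ j) ↔ MeetsOther Γ t j := by
  unfold MeetsOther
  rw [← σ.exists_congr_right]
  simp

lemma isHair_act {n : ℕ} (σ : Equiv.Perm (Fin n)) (Γ : Graph n) (a : Fin n) :
    IsHair (act σ Γ) (σ a) ↔ IsHair Γ a := by
  unfold IsHair
  rw [← σ.forall_congr_right, ← σ.exists_congr_right]
  simp only [act_apply, map_perm_eq_some, ne_eq, meetsOther_act]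

lemma grow_act {n : ℕ} (σ : Equiv.Perm (Fin n)) (Γ : Graph n) (a : Fin n) :
    grow (act σ Γ) (σ a) = act (Equiv.Perm.decomposeFin.symm (0, σ)) (grow Γ a) := by
  have hm (o : Option (Fin n)) : (o.map σ).map Fin.succ =
      (o.map Fin.succ).map (Equiv.Perm.decomposeFin.symm (0, σ)) := by
    cases o <;> simp
  funext k
  obtain ⟨k, rfl⟩ := (Equiv.Perm.decomposeFin.symm (0, σ)).surjective k
  rw [act_apply]
  refine Fin.cases ?_ (fun k => ?_) k
  · simpa using hm (Γ a)
  · by_cases hk : k = a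
    · simp [hk]
    · simpa [hk] using hm (Γ k)

/-- The extended permutation fixes `0`, so the new vertex takes part in no inversion. -/
lemma koszulSign_grow {n : ℕ} (σ : Equiv.Perm (Fin n)) {Γ : Graph n} {a : Fin n}
    (ha : Γ a ≠ none) :
    koszulSign (deb (grow Γ a)) (Equiv.Perm.decomposeFin.symm (0, σ)) = koszulSign (deb Γ) σ := by
  unfold koszulSign
  simp only [odd_deb_iff, Fin.prod_univ_succ (n := n)]
  simp [grow_succ_eq_none ha, -grow_succ, -grow_zero]

/-! ### The averaged primitive -/

open Classical in
/-- The number of hairs. -/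
noncomputable def hairCount {n : ℕ} (Γ : Graph n) : ℝ := ∑ a, if IsHair Γ a then 1 else 0

open Classical in
/-- Minus the mean value of `δ` over the graphs obtained by lengthening a hair, or `0` where there
are no hairs. -/
noncomputable def hairPrimitive {n : ℕ} (δ : Comb (n + 1)) : Comb n :=
  fun Γ => -((hairCount Γ)⁻¹ * ∑ a, if IsHair Γ a then δ (grow Γ a) else 0)

lemma hairCount_act {n : ℕ} (σ : Equiv.Perm (Fin n)) (Γ : Graph n) :
    hairCount (act σ Γ) = hairCount Γ := by
  classical
  unfold hairCount
  rw [← Equiv.sum_comp σ]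
  simp only [isHair_act]

lemma IsContractible.hairCount_contract {n : ℕ} {Γ : Graph (n + 1)} {i : Fin n} {j : Fin (n + 1)}
    (h : IsContractible Γ i j) : hairCount (contract Γ i j) = hairCount Γ := by
  classical
  unfold hairCount
  rw [Fin.sum_univ_succAbove _ j, if_neg h.not_isHair, zero_add]
  simp only [h.isHair_contract]

lemma IsSymmetric.hairPrimitive {n : ℕ} {δ : Comb (n + 1)} (hδ : IsSymmetric δ) :
    IsSymmetric (hairPrimitive δ) := by
  classical
  intro σ Γ
  have h : (∑ a, if IsHair (act σ Γ) a then δ (grow (act σ Γ) a) else 0) =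
      (koszulSign (deb Γ) σ : ℝ) * ∑ a, if IsHair Γ a then δ (grow Γ a) else 0 := by
    rw [← Equiv.sum_comp σ, mul_sum]
    refine sum_congr rfl fun a _ => ?_
    simp only [isHair_act]
    split_ifs with ha
    · obtain ⟨-, t, hat, -⟩ := ha
      rw [grow_act, hδ, koszulSign_grow σ (by simp [hat])]
    · simp
  simp only [VectorGraph.hairPrimitive, h, hairCount_act]
  ring

/-- Summing the homotopy identity over the hairs gives `hairCount Γ * δ Γ`. With `0⁻¹ = 0`, the
factor is the indicator of the graphs with hairs. -/
lemma coboundary_hairPrimitive {n : ℕ} {δ : Comb (n + 1)} (hδ : coboundary δ = 0)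
    (Γ : Graph (n + 1)) :
    coboundary (hairPrimitive δ) Γ = (hairCount Γ)⁻¹ * hairCount Γ * δ Γ := by
  classical
  have h1 (j : Fin (n + 1)) (i : Fin n) : (if IsContractible Γ i j then
      (frontSign Γ j : ℝ) * hairPrimitive δ (contract Γ i j) else 0) =
      -((hairCount Γ)⁻¹ * ∑ a, if IsHair Γ a then (if IsContractible Γ i j then
        (frontSign Γ j : ℝ) * δ (contract (grow Γ a) i.succ j.succ) else 0) else 0) := by
    split_ifs with hc
    · rw [Fin.sum_univ_succAbove _ j, if_neg hc.not_isHair, zero_add]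
      simp only [hairPrimitive, hc.hairCount_contract, hc.isHair_contract, contract_grow_succ,
        mul_neg, mul_left_comm _ (hairCount Γ)⁻¹, mul_sum, mul_ite, mul_zero]
    · simp
  have h2 (a : Fin (n + 1)) : (∑ j, ∑ i, if IsHair Γ a then (if IsContractible Γ i j then
        (frontSign Γ j : ℝ) * δ (contract (grow Γ a) i.succ j.succ) else 0) else 0) =
      (if IsHair Γ a then 1 else 0) * δ Γ := by
    split_ifs with ha
    · rw [one_mul, eq_sum_of_coboundary_eq_zero hδ ha]
    · simp
  rw [coboundary_apply]
  simp only [h1, sum_neg_distrib, neg_neg, ← mul_sum]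
  rw [mul_assoc, show hairCount Γ = ∑ a, if IsHair Γ a then 1 else 0 from rfl, sum_mul]
  congr 1
  simp only [← h2]
  exact (sum_congr rfl fun j _ => sum_comm).trans sum_comm

lemma IsSymmetric.mul_of_act_eq {n : ℕ} {δ f : Comb n} (hδ : IsSymmetric δ)
    (hf : ∀ σ Γ, f (act σ Γ) = f Γ) : IsSymmetric (f * δ) := by
  intro σ Γ
  simp only [Pi.mul_apply, hf, hδ σ Γ]
  ring

/-- Used to see that the hairless part of a cocycle is closed, without the identity `∂² = 0`. -/
lemma coboundary_mul {n : ℕ} (δ f : Comb n) (g : Comb (n + 1))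
    (hf : ∀ Γ i j, IsContractible Γ i j → f (contract Γ i j) = g Γ) :
    coboundary (f * δ) = g * coboundary δ := by
  classical
  funext Γ
  simp only [Pi.mul_apply, coboundary_apply, mul_neg, mul_sum]
  congr 1
  refine sum_congr rfl fun j _ => sum_congr rfl fun i _ => ?_
  split_ifs with h
  · rw [hf Γ i j h]
    ring
  · simp

/-! ### Hairless graphs -/

lemma isSimple_of_forall_not_isHair {n : ℕ} {Γ : Graph n} (h : ∀ a, ¬ IsHair Γ a) (i : Fin n) :
    IsSimple Γ i := by
  classical
  have htarget {a t : Fin n} (ha : ∀ k, Γ k ≠ some a) (hat : Γ a = some t) :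
      Γ t = none ∧ ∀ k, Γ k = some t → k = a := by
    have hm : ¬ MeetsOther Γ t a := fun hm => h a ⟨ha, t, hat, hm⟩
    simp only [MeetsOther, ne_eq, not_or, not_not, not_exists, not_and] at hm
    exact ⟨hm.1, fun k hk => by_contra fun hka => hm.2 k hka hk⟩
  let B := univ.filter fun k => Γ k ≠ none
  have hBI : B.card ≤ (B.image Γ).card := by
    refine card_le_card_of_injOn
      -- Sources inject into targets: a source that is a target goes to itself, any other to its own
      -- target, which by `htarget` is no source and receives only that arrow. Hence `Γ` is
      -- injective on `B`.
      (fun k => if ∃ l, Γ l = some k then some k else Γ k) (fun k hk => ?_)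
      fun k hk l hl hkl => ?_
    · have hk : Γ k ≠ none := by simpa [B] using hk
      simp only [coe_image, Set.mem_image]
      split_ifs with hex
      · obtain ⟨l, hl⟩ := hex
        exact ⟨l, by simp [B, hl], hl⟩
      · exact ⟨k, by simp [B, hk], rfl⟩
    · have hk : Γ k ≠ none := by simpa [B] using hk
      have hl : Γ l ≠ none := by simpa [B] using hl
      dsimp only at hkl
      split_ifs at hkl with hek hel hel
      · simpa using hkl
      · exact absurd (htarget (by simpa using hel) hkl.symm).1 hk
      · exact absurd (htarget (by simpa using hek) hkl).1 hl
      · obtain ⟨t, ht⟩ := Option.ne_none_iff_exists'.1 hk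
        exact ((htarget (by simpa using hek) ht).2 l (hkl ▸ ht)).symm
  have hinj : Set.InjOn Γ B := card_image_iff.1 (card_image_le.antisymm hBI)
  refine card_le_one.2 fun k hk l hl => hinj ?_ ?_ ?_ <;> simp_all [fin, B]

lemma forall_not_isHair_of_hairCount {n : ℕ} {Γ : Graph n} (h : hairCount Γ = 0) (a : Fin n) :
    ¬ IsHair Γ a := by
  classical
  intro ha
  rw [hairCount, sum_eq_zero_iff_of_nonneg fun _ _ => by split_ifs <;> norm_num] at h
  simpa [ha] using h a (mem_univ a)

end VectorGraph

open VectorGraph in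
theorem mainTheorem4 (n : ℕ) (δ : VectorGraph.Comb n) (hδ : VectorGraph.IsCocycle δ) :
    ∃ γ : VectorGraph.Comb n, VectorGraph.IsCoboundary γ ∧ VectorGraph.IsCocycle (δ - γ) ∧
      ∀ Δ : VectorGraph.Graph n, VectorGraph.symbol (δ - γ) Δ ≠ 0 →
        ∀ i : Fin n, VectorGraph.IsSimple Δ i := by
  obtain _ | n := n
  · exact ⟨0, rfl, by simpa using hδ, fun _ _ i => i.elim0⟩
  obtain ⟨hsymm, hclosed⟩ := hδ
  have hdiff : δ - coboundary (hairPrimitive δ) =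
      (fun Γ => 1 - (hairCount Γ)⁻¹ * hairCount Γ) * δ := by
    funext Γ
    rw [Pi.sub_apply, coboundary_hairPrimitive hclosed, Pi.mul_apply]
    ring
  refine ⟨_, ⟨_, hsymm.hairPrimitive, rfl⟩, ?_, fun Δ hΔ => ?_⟩
  · rw [hdiff]
    refine ⟨hsymm.mul_of_act_eq fun σ Γ => by simp only [hairCount_act], ?_⟩
    rw [coboundary_mul δ _ (fun Γ => 1 - (hairCount Γ)⁻¹ * hairCount Γ)
      fun Γ i j h => by simp only [h.hairCount_contract], hclosed, mul_zero]
  · refine isSimple_of_forall_not_isHair (forall_not_isHair_of_hairCount ?_)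
    by_contra h0
    have hzero : (δ - coboundary (hairPrimitive δ)) Δ = 0 := by
      simp [hdiff, inv_mul_cancel₀ h0, -Pi.sub_apply]
    exact hΔ (by simp only [symbol, hzero, ite_self])
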